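/- Let $n\in\mathbb{N}$, let $m_1,m_2\in\mathbb{R}^n$, let $M_1,M_2\in\mathbb{R}^{n\times n}$ be symmetric positive semidefinite, and let $P,Q,R\in\mathbb{R}^{n\times n}$ be symmetric. Let $\mathbb{P}_1=N(m_1,M_1)$ and $\mathbb{P}_2=N(m_2,M_2)$ be the (possibly degenerate) Gaussian measures on $\mathbb{R}^n$ with these means and covariance matrices, and let $\Pi(\mathbb{P}_1,\mathbb{P}_2)$ be the set of Borel probability measures on $\mathbb{R}^n\times\mathbb{R}^n$ with first marginal $\mathbb{P}_1$ and second marginal $\mathbb{P}_2$. Then the function $\xi_1^\top P\xi_1+\xi_2^\top Q\xi_2+\xi_1^\top R\xi_2$ of $(\xi_1,\xi_2)\in\mathbb{R}^n\times\mathbb{R}^n$ is integrable under every $\pi\in\Pi(\mathbb{P}_1,\mathbb{P}_2)$, and $$\inf_{\pi\in\Pi(\mathbb{P}_1,\mathbb{P}_2)}\int\bigl(\xi_1^\top P\xi_1+\xi_2^\top Q\xi_2+\xi_1^\top R\xi_2\bigr)\,\pi(d\xi_1,d\xi_2) = m_1^\top Pm_1+m_2^\top Qm_2+m_1^\top Rm_2+\operatorname{tr}[PM_1]+\operatorname{tr}[QM_2]-\operatorname{tr}\Bigl[\sqrt{\sqrt{M_1}\,R\,M_2\,R\,\sqrt{M_1}}\Bigr],$$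 where $\sqrt{X}$ denotes the positive semidefinite square root of a symmetric positive semidefinite matrix $X$. -/

import Mathlib

open MeasureTheory ProbabilityTheory Matrix
open scoped MatrixOrder

/-- The set `Π(μ, ν)` of couplings of `μ` and `ν`: probability measures on the product space
whose first marginal is `μ` and whose second marginal is `ν`. -/
def couplings {X Y : Type*} [MeasurableSpace X] [MeasurableSpace Y]
    (μ : Measure X) (ν : Measure Y) : Set (Measure (X × Y)) :=
  {π | IsProbabilityMeasure π ∧ π.map Prod.fst = μ ∧ π.map Prod.snd = ν}

/-- The set of all values `∫ c dπ` of the transport cost over the couplings `π ∈ Π(μ, ν)`.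
The optimal transport value is the infimum of this set. -/
def transportCosts {X Y : Type*} [MeasurableSpace X] [MeasurableSpace Y]
    (μ : Measure X) (ν : Measure Y) (c : X × Y → ℝ) : Set ℝ :=
  {r | ∃ π ∈ couplings μ ν, r = ∫ z, c z ∂π}

/-- The cost `(ξ₁, ξ₂) ↦ ξ₁ᵀ P ξ₁ + ξ₂ᵀ Q ξ₂ + ξ₁ᵀ R ξ₂`. -/
def quadCost {n : ℕ} (P Q R : Matrix (Fin n) (Fin n) ℝ)
    (ξ : EuclideanSpace ℝ (Fin n) × EuclideanSpace ℝ (Fin n)) : ℝ :=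
  ξ.1.ofLp ⬝ᵥ P *ᵥ ξ.1.ofLp + ξ.2.ofLp ⬝ᵥ Q *ᵥ ξ.2.ofLp + ξ.1.ofLp ⬝ᵥ R *ᵥ ξ.2.ofLp

/-!
The cost of a coupling `π` depends on `π` only through the cross-covariance matrix `C` of the two
marginals: it is `tr (Rᵀ C)` plus a constant. The joint law may be taken Gaussian, so the matrices
`C` that occur are exactly those for which the block matrix with rows `(M₁, C)` and `(Cᵀ, M₂)` is
positive semidefinite. A Gram factorization of this block matrix and polar decompositions of its
two column blocks write such a `C` as `√M₁ U₁ᵀ U₂ √M₂` with contractions `U₁` and `U₂`. If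
`√M₂ Rᵀ √M₁ = W N` is a polar decomposition, with `N` the square root in the theorem and `W` a
contraction, then `tr (Rᵀ C) = tr (N U₁ᵀ U₂ W)`. Expanding `0 ≤ tr (N (U₁ + U₂ W)ᵀ (U₁ + U₂ W))`
bounds this below by `-tr N`, and `C = -√M₁ Wᵀ √M₂` attains the bound.
-/

section Couplings

variable {α β : Type*} [MeasurableSpace α] [MeasurableSpace β] {μ : Measure α} {ν : Measure β}
  {π : Measure (α × β)}

lemma hasLaw_fst_of_mem_couplings (hπ : π ∈ couplings μ ν) : HasLaw Prod.fst μ π :=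
  ⟨measurable_fst.aemeasurable, hπ.2.1⟩

lemma hasLaw_snd_of_mem_couplings (hπ : π ∈ couplings μ ν) : HasLaw Prod.snd ν π :=
  ⟨measurable_snd.aemeasurable, hπ.2.2⟩

lemma transportCosts_eq_image (μ : Measure α) (ν : Measure β) (c : α × β → ℝ) :
    transportCosts μ ν c = (fun π ↦ ∫ z, c z ∂π) '' couplings μ ν := by
  simp only [transportCosts, Set.image, eq_comm]

end Couplings

section CrossTerm

open scoped ComplexOrder

variable {𝕜 ι κ : Type*} [RCLike 𝕜] [Fintype ι] [Fintype κ]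

lemma re_trace_mul_nonneg {A B : Matrix ι ι 𝕜} (hA : A.PosSemidef) (hB : B.PosSemidef) :
    0 ≤ RCLike.re (A * B).trace := by
  classical
  obtain ⟨G, rfl⟩ := CStarAlgebra.nonneg_iff_eq_star_mul_self.mp hA.nonneg
  rw [star_eq_conjTranspose, trace_mul_cycle, trace_mul_comm, ← Matrix.mul_assoc]
  exact (RCLike.nonneg_iff.mp (hB.mul_mul_conjTranspose_same G).trace_nonneg).1

lemma exists_isStarProjection_mul {N : Matrix ι ι 𝕜} (hN : N.IsHermitian) :
    ∃ T : Matrix ι ι 𝕜, T.IsHermitian ∧ IsStarProjection (T * N) ∧ T * N * N = N := by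
  classical
  have hcont (f : ℝ → ℝ) : ContinuousOn f (spectrum ℝ N) := finite_real_spectrum.continuousOn f
  have hsa : IsSelfAdjoint N := hN
  -- As `0⁻¹ = 0`, this is the Moore-Penrose inverse of `N`.
  set T := cfc (fun x : ℝ ↦ x⁻¹) N
  have hTN : T * N = cfc (fun x : ℝ ↦ x⁻¹ * x) N := by
    rw [cfc_mul _ _ N (hcont _) (hcont _), cfc_id' ℝ N]
  refine ⟨T, cfc_predicate (R := ℝ) _ N, hTN ▸ ⟨?_, cfc_predicate (R := ℝ) _ N⟩, ?_⟩
  · rw [IsIdempotentElem, ← cfc_mul _ _ N (hcont _) (hcont _)]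
    refine cfc_congr fun x _ ↦ ?_
    rcases eq_or_ne x 0 with rfl | hx <;> simp [*]
  · nth_rw 2 3 [← cfc_id' ℝ N]
    rw [hTN, ← cfc_mul _ _ N (hcont _) (hcont _)]
    exact cfc_congr fun x _ ↦ by simp

variable [DecidableEq ι]

lemma conjTranspose_sqrt (M : Matrix ι ι 𝕜) : (CFC.sqrt M)ᴴ = CFC.sqrt M :=
  (CFC.sqrt_nonneg M).posSemidef.isHermitian

theorem exists_polarDecomposition (A : Matrix κ ι 𝕜) :
    ∃ U : Matrix κ ι 𝕜, Uᴴ * U ≤ 1 ∧ U * CFC.sqrt (Aᴴ * A) = A ∧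
      Uᴴ * A = CFC.sqrt (Aᴴ * A) := by
  set N := CFC.sqrt (Aᴴ * A)
  have hN : N.IsHermitian := conjTranspose_sqrt _
  have hNN : N * N = Aᴴ * A :=
    CFC.sqrt_mul_sqrt_self _ (posSemidef_conjTranspose_mul_self A).nonneg
  obtain ⟨T, hT, hTN, hTNN⟩ := exists_isStarProjection_mul hN
  have hcomm : N * T = T * N := by
    simpa only [star_mul, star_eq_conjTranspose, hT.eq, hN.eq] using hTN.isSelfAdjoint.star_eq
  refine ⟨A * T, ?_, ?_, ?_⟩
  · calc (A * T)ᴴ * (A * T) = T * (Aᴴ * A) * T := by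
          rw [conjTranspose_mul, hT.eq]; simp only [Matrix.mul_assoc]
      _ = T * N * (N * T) := by rw [← hNN]; simp only [Matrix.mul_assoc]
      _ = T * N * (T * N) := by rw [hcomm]
      _ = T * N := hTN.isIdempotentElem
      _ ≤ 1 := hTN.le_one
  · have hker : N * (T * N - 1) = 0 := by
      rw [mul_sub, mul_one, ← Matrix.mul_assoc, hcomm, hTNN, sub_self]
    have hsub : A * T * N - A = A * (T * N - 1) := by
      rw [Matrix.mul_sub, Matrix.mul_one, Matrix.mul_assoc]
    rw [← sub_eq_zero, hsub, ← conjTranspose_mul_self_eq_zero, conjTranspose_mul,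
      Matrix.mul_assoc, ← Matrix.mul_assoc Aᴴ, ← hNN, Matrix.mul_assoc N, hker, Matrix.mul_zero,
      Matrix.mul_zero]
  · rw [conjTranspose_mul, hT.eq, Matrix.mul_assoc, ← hNN, ← Matrix.mul_assoc, hTNN]

lemma neg_re_trace_le_re_trace_mul {X Y : Matrix κ ι 𝕜} {N : Matrix ι ι 𝕜} (hN : N.PosSemidef)
    (hX : Xᴴ * X ≤ 1) (hY : Yᴴ * Y ≤ 1) :
    -RCLike.re N.trace ≤ RCLike.re (N * (Xᴴ * Y)).trace := by
  have hsum := re_trace_mul_nonneg hN (posSemidef_conjTranspose_mul_self (X + Y))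
  have hXN := re_trace_mul_nonneg hN (le_iff.mp hX)
  have hYN := re_trace_mul_nonneg hN (le_iff.mp hY)
  have hcross : RCLike.re (N * (Yᴴ * X)).trace = RCLike.re (N * (Xᴴ * Y)).trace := by
    rw [← RCLike.conj_re, ← RCLike.star_def, ← trace_conjTranspose, conjTranspose_mul,
      conjTranspose_mul, conjTranspose_conjTranspose, hN.isHermitian.eq, trace_mul_comm]
  simp only [conjTranspose_add, Matrix.add_mul, Matrix.mul_add, Matrix.mul_sub, Matrix.mul_one,
    trace_add, trace_sub, map_add, map_sub] at hsum hXN hYN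
  linarith

omit [Fintype ι] in
lemma conjTranspose_mul_self_mul_le_one [Finite ι] [DecidableEq κ] {l : Type*} [Fintype l]
    {U : Matrix l κ 𝕜} {W : Matrix κ ι 𝕜} (hU : Uᴴ * U ≤ 1) (hW : Wᴴ * W ≤ 1) :
    (U * W)ᴴ * (U * W) ≤ 1 := by
  have hconj := (le_iff.mp hU).conjTranspose_mul_mul_same W
  rw [Matrix.mul_sub, Matrix.sub_mul, Matrix.mul_one] at hconj
  refine le_trans (le_iff.mpr ?_) hW
  simpa only [conjTranspose_mul, Matrix.mul_assoc] using hconj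

variable {M₁ : Matrix ι ι 𝕜} {M₂ : Matrix κ κ 𝕜}

lemma exists_eq_sqrt_mul_mul_sqrt [DecidableEq κ] {C : Matrix ι κ 𝕜}
    (h : (fromBlocks M₁ C Cᴴ M₂).PosSemidef) :
    ∃ (U₁ : Matrix (ι ⊕ κ) ι 𝕜) (U₂ : Matrix (ι ⊕ κ) κ 𝕜), U₁ᴴ * U₁ ≤ 1 ∧ U₂ᴴ * U₂ ≤ 1 ∧
      C = CFC.sqrt M₁ * (U₁ᴴ * U₂) * CFC.sqrt M₂ := by
  obtain ⟨F, hF⟩ := CStarAlgebra.nonneg_iff_eq_star_mul_self.mp h.nonneg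
  rw [← fromCols_toCols F, star_eq_conjTranspose, conjTranspose_fromCols_eq_fromRows_conjTranspose,
    fromRows_mul_fromCols, fromBlocks_inj] at hF
  obtain ⟨rfl, rfl, -, rfl⟩ := hF
  obtain ⟨U₁, hU₁, hF₁, -⟩ := exists_polarDecomposition F.toCols₁
  obtain ⟨U₂, hU₂, hF₂, -⟩ := exists_polarDecomposition F.toCols₂
  refine ⟨U₁, U₂, hU₁, hU₂, ?_⟩
  nth_rw 1 [← hF₁, ← hF₂]
  rw [conjTranspose_mul, conjTranspose_sqrt]
  simp only [Matrix.mul_assoc]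

lemma posSemidef_fromBlocks_sqrt_mul_mul_sqrt [DecidableEq κ] (hM₁ : M₁.PosSemidef)
    (hM₂ : M₂.PosSemidef) {W : Matrix κ ι 𝕜} (hW : Wᴴ * W ≤ 1) :
    (fromBlocks M₁ (CFC.sqrt M₁ * Wᴴ * CFC.sqrt M₂)
      (CFC.sqrt M₁ * Wᴴ * CFC.sqrt M₂)ᴴ M₂).PosSemidef := by
  have hblock : (fromBlocks 1 Wᴴ W (1 : Matrix κ κ 𝕜)).PosSemidef := by
    let : Invertible (1 : Matrix κ κ 𝕜) := invertibleOne
    simpa using (PosDef.fromBlocks₂₂ 1 Wᴴ PosDef.one).mpr (by simpa using le_iff.mp hW)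
  have h := hblock.conjTranspose_mul_mul_same (fromBlocks (CFC.sqrt M₁) 0 0 (CFC.sqrt M₂))
  simpa [fromBlocks_conjTranspose, fromBlocks_multiply, conjTranspose_sqrt, Matrix.mul_assoc,
    CFC.sqrt_mul_sqrt_self _ hM₁.nonneg, CFC.sqrt_mul_sqrt_self _ hM₂.nonneg] using h

theorem isLeast_re_trace_of_posSemidef_fromBlocks (hM₁ : M₁.PosSemidef) (hM₂ : M₂.PosSemidef)
    (R : Matrix ι κ 𝕜) :
    IsLeast ((fun C : Matrix ι κ 𝕜 ↦ RCLike.re (Rᴴ * C).trace) ''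
        {C | (fromBlocks M₁ C Cᴴ M₂).PosSemidef})
      (-RCLike.re (CFC.sqrt (CFC.sqrt M₁ * R * M₂ * Rᴴ * CFC.sqrt M₁)).trace) := by
  classical
  set S₁ := CFC.sqrt M₁
  set S₂ := CFC.sqrt M₂
  have hgram : S₁ * R * M₂ * Rᴴ * S₁ = (S₂ * Rᴴ * S₁)ᴴ * (S₂ * Rᴴ * S₁) := by
    simp only [S₁, S₂, conjTranspose_mul, conjTranspose_sqrt, conjTranspose_conjTranspose]
    nth_rw 1 [← CFC.sqrt_mul_sqrt_self M₂ hM₂.nonneg]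
    simp only [Matrix.mul_assoc]
  have hcyc (K : Matrix ι κ 𝕜) : (Rᴴ * (S₁ * K * S₂)).trace = (K * (S₂ * Rᴴ * S₁)).trace := by
    rw [← Matrix.mul_assoc, trace_mul_comm, ← Matrix.mul_assoc, ← Matrix.mul_assoc,
      trace_mul_comm, ← Matrix.mul_assoc]
  obtain ⟨W, hW, hWN, hWA⟩ := exists_polarDecomposition (S₂ * Rᴴ * S₁)
  rw [← hgram] at hWN hWA
  set N := CFC.sqrt (S₁ * R * M₂ * Rᴴ * S₁)
  constructor
  · refine ⟨S₁ * (-W)ᴴ * S₂,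
      posSemidef_fromBlocks_sqrt_mul_mul_sqrt hM₁ hM₂ (by simpa using hW), ?_⟩
    simp only [hcyc, conjTranspose_neg, Matrix.neg_mul, trace_neg, hWA, map_neg]
  · rintro _ ⟨C, hC, rfl⟩
    obtain ⟨U₁, U₂, hU₁, hU₂, rfl⟩ := exists_eq_sqrt_mul_mul_sqrt hC
    have htr : (Rᴴ * (S₁ * (U₁ᴴ * U₂) * S₂)).trace = (N * (U₁ᴴ * (U₂ * W))).trace := by
      rw [hcyc, ← hWN, trace_mul_comm N]
      simp only [Matrix.mul_assoc]
    exact (neg_re_trace_le_re_trace_mul (CFC.sqrt_nonneg _).posSemidef hU₁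
      (conjTranspose_mul_self_mul_le_one hU₂ hW)).trans_eq (congrArg RCLike.re htr.symm)

end CrossTerm

section CrossCovariance

variable {Ω ι κ : Type*} [MeasurableSpace Ω] {μ : Measure Ω}
  {X : Ω → EuclideanSpace ℝ ι} {Y : Ω → EuclideanSpace ℝ κ}

/-- The cross-covariance matrix `(cov(Xᵢ, Yⱼ))ᵢⱼ` of two random vectors; `crossCov X X μ` is the
covariance matrix of `X`. -/
noncomputable def crossCov (X : Ω → EuclideanSpace ℝ ι) (Y : Ω → EuclideanSpace ℝ κ)
    (μ : Measure Ω) : Matrix ι κ ℝ :=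
  of fun i j ↦ cov[fun ω ↦ X ω i, fun ω ↦ Y ω j; μ]

lemma crossCov_transpose : (crossCov X Y μ)ᵀ = crossCov Y X μ := by
  ext i j
  exact covariance_comm ..

variable [Fintype ι]

lemma trace_transpose_mul_crossCov_self (A : Matrix ι ι ℝ) :
    (Aᵀ * crossCov X X μ).trace = (A * crossCov X X μ).trace := by
  rw [← trace_transpose, transpose_mul, transpose_transpose, crossCov_transpose, trace_mul_comm]

variable [Fintype κ]

lemma crossCov_sumEquivProd_symm :
    crossCov (fun ω ↦ EuclideanSpace.sumEquivProd.symm (X ω, Y ω))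
        (fun ω ↦ EuclideanSpace.sumEquivProd.symm (X ω, Y ω)) μ =
      fromBlocks (crossCov X X μ) (crossCov X Y μ) (crossCov X Y μ)ᵀ (crossCov Y Y μ) := by
  rw [crossCov_transpose]
  ext (i | i) (j | j) <;> rfl

lemma dotProduct_crossCov_mulVec [IsFiniteMeasure μ] (hX : MemLp X 2 μ) (hY : MemLp Y 2 μ)
    (a : ι → ℝ) (b : κ → ℝ) :
    a ⬝ᵥ crossCov X Y μ *ᵥ b =
      cov[fun ω ↦ ∑ i, a i * X ω i, fun ω ↦ ∑ j, b j * Y ω j; μ] := by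
  rw [covariance_fun_sum_fun_sum (fun i ↦ (hX.eval_piLp i).const_mul (a i))
    (fun j ↦ (hY.eval_piLp j).const_mul (b j))]
  simp only [dotProduct, mulVec, Finset.mul_sum, crossCov, of_apply, covariance_const_mul_left,
    covariance_const_mul_right]
  refine Finset.sum_congr rfl fun i _ ↦ Finset.sum_congr rfl fun j _ ↦ ?_
  ring

lemma covarianceBilin_map_eq_dotProduct_crossCov_mulVec [IsFiniteMeasure μ] (hX : MemLp X 2 μ)
    (x y : EuclideanSpace ℝ ι) :
    covarianceBilin (μ.map X) x y = x ⬝ᵥ crossCov X X μ *ᵥ y := by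
  have hid : MemLp id 2 (μ.map X) := (memLp_map_measure_iff aestronglyMeasurable_id
    hX.aemeasurable).mpr hX
  rw [covarianceBilin_apply_eq_cov hid, dotProduct_crossCov_mulVec hX hX,
    covariance_map_fun (by fun_prop) (by fun_prop) hX.aemeasurable]
  simp only [PiLp.inner_apply, RCLike.inner_apply, conj_trivial, mul_comm]

lemma posSemidef_crossCov_self [IsFiniteMeasure μ] (hX : MemLp X 2 μ) :
    (crossCov X X μ).PosSemidef := by
  refine .of_dotProduct_mulVec_nonneg crossCov_transpose fun a ↦ ?_
  rw [star_trivial, dotProduct_crossCov_mulVec hX hX, covariance_self]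
  · exact variance_nonneg _ _
  · exact (memLp_finsetSum _ fun i _ ↦ (hX.eval_piLp i).const_mul (a i)).aemeasurable

lemma posSemidef_fromBlocks_crossCov [IsFiniteMeasure μ] (hX : MemLp X 2 μ) (hY : MemLp Y 2 μ) :
    (fromBlocks (crossCov X X μ) (crossCov X Y μ) (crossCov X Y μ)ᵀ
      (crossCov Y Y μ)).PosSemidef := by
  rw [← crossCov_sumEquivProd_symm]
  refine posSemidef_crossCov_self (.of_eval_piLp ?_)
  rintro (i | j)
  exacts [hX.eval_piLp i, hY.eval_piLp j]

lemma integrable_dotProduct_mulVec (hX : MemLp X 2 μ) (hY : MemLp Y 2 μ) (A : Matrix ι κ ℝ) :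
    Integrable (fun ω ↦ X ω ⬝ᵥ A *ᵥ Y ω) μ := by
  simp only [dotProduct, mulVec, Finset.mul_sum]
  exact integrable_finsetSum _ fun i _ ↦ integrable_finsetSum _ fun j _ ↦
    (hX.eval_piLp i).integrable_mul ((hY.eval_piLp j).const_mul (A i j))

lemma integral_dotProduct_mulVec [IsProbabilityMeasure μ] (hX : MemLp X 2 μ) (hY : MemLp Y 2 μ)
    (A : Matrix ι κ ℝ) :
    ∫ ω, X ω ⬝ᵥ A *ᵥ Y ω ∂μ =
      (∫ ω, X ω ∂μ).ofLp ⬝ᵥ A *ᵥ (∫ ω, Y ω ∂μ).ofLp + (Aᵀ * crossCov X Y μ).trace := by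
  have hterm (i : ι) (j : κ) : Integrable (fun ω ↦ X ω i * (A i j * Y ω j)) μ :=
    (hX.eval_piLp i).integrable_mul ((hY.eval_piLp j).const_mul (A i j))
  have hmul (i : ι) (j : κ) : ∫ ω, X ω i * (A i j * Y ω j) ∂μ =
      (∫ ω, X ω ∂μ) i * (A i j * (∫ ω, Y ω ∂μ) j) + A i j * crossCov X Y μ i j := by
    rw [crossCov, of_apply, covariance_eq_sub (hX.eval_piLp i) (hY.eval_piLp j),
      eval_integral_piLp fun i ↦ (hX.eval_piLp i).integrable one_le_two,
      eval_integral_piLp fun j ↦ (hY.eval_piLp j).integrable one_le_two]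
    simp only [mul_left_comm _ (A i j), integral_const_mul, Pi.mul_apply]
    ring
  have htrace : (Aᵀ * crossCov X Y μ).trace = ∑ i, ∑ j, A i j * crossCov X Y μ i j := by
    simp only [trace, diag_apply, mul_apply, transpose_apply]
    exact Finset.sum_comm
  simp only [dotProduct, mulVec, Finset.mul_sum, htrace, ← Finset.sum_add_distrib]
  rw [integral_finsetSum _ fun i _ ↦ integrable_finsetSum _ fun j _ ↦ hterm i j]
  refine Finset.sum_congr rfl fun i _ ↦ ?_
  rw [integral_finsetSum _ fun j _ ↦ hterm i j]
  exact Finset.sum_congr rfl fun j _ ↦ hmul i j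

end CrossCovariance

section Gaussian

variable {Ω ι κ : Type*} [MeasurableSpace Ω] {P : Measure Ω} [Fintype ι] [DecidableEq ι]

section

variable {X : Ω → EuclideanSpace ℝ ι} {m : EuclideanSpace ℝ ι} {M : Matrix ι ι ℝ}

lemma integral_of_hasLaw_multivariateGaussian (hX : HasLaw X (multivariateGaussian m M) P) :
    ∫ ω, X ω ∂P = m := by
  rw [hX.integral_eq, integral_id_multivariateGaussian]

lemma crossCov_self_of_hasLaw_multivariateGaussian (hM : M.PosSemidef)
    (hX : HasLaw X (multivariateGaussian m M) P) : crossCov X X P = M := by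
  ext i j
  rw [← covariance_eval_multivariateGaussian (μ := m) hM i j]
  exact hX.covariance_fun_comp (f := fun x ↦ x i) (g := fun x ↦ x j) (by fun_prop) (by fun_prop)

lemma hasLaw_multivariateGaussian_crossCov (hX : HasGaussianLaw X P) :
    HasLaw X (multivariateGaussian (∫ ω, X ω ∂P) (crossCov X X P)) P := by
  have := hX.isProbabilityMeasure
  have := hX.isGaussian_map
  refine ⟨hX.aemeasurable, IsGaussian.ext ?_ ?_⟩
  · simp only [id_eq, integral_id_multivariateGaussian]
    exact integral_map hX.aemeasurable aestronglyMeasurable_id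
  · ext x y
    rw [covarianceBilin_map_eq_dotProduct_crossCov_mulVec hX.memLp_two,
      covarianceBilin_multivariateGaussian (posSemidef_crossCov_self hX.memLp_two)]

end

variable [Fintype κ] [DecidableEq κ] {M₁ : Matrix ι ι ℝ} {M₂ : Matrix κ κ ℝ}

theorem exists_mem_couplings_multivariateGaussian_crossCov_eq (m₁ : EuclideanSpace ℝ ι)
    (m₂ : EuclideanSpace ℝ κ) {C : Matrix ι κ ℝ} (hC : (fromBlocks M₁ C Cᵀ M₂).PosSemidef) :
    ∃ π ∈ couplings (multivariateGaussian m₁ M₁) (multivariateGaussian m₂ M₂),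
      crossCov Prod.fst Prod.snd π = C := by
  let e : EuclideanSpace ℝ (ι ⊕ κ) ≃L[ℝ] EuclideanSpace ℝ ι × EuclideanSpace ℝ κ :=
    EuclideanSpace.sumEquivProd
  set π := (multivariateGaussian (e.symm (m₁, m₂)) (fromBlocks M₁ C Cᵀ M₂)).map e
  have hlaw : HasLaw e.symm (multivariateGaussian (e.symm (m₁, m₂)) (fromBlocks M₁ C Cᵀ M₂)) π :=
    ⟨by fun_prop, by rw [Measure.map_map (by fun_prop) (by fun_prop), e.symm_comp_self,
      Measure.map_id]⟩
  have hid : HasGaussianLaw (fun z : EuclideanSpace ℝ ι × EuclideanSpace ℝ κ ↦ (z.1, z.2)) π :=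
    IsGaussian.hasGaussianLaw_id
  have hmean : ∫ z, z ∂π = (m₁, m₂) := by
    rw [← e.symm.injective.eq_iff, ← e.symm.integral_comp_comm,
      integral_of_hasLaw_multivariateGaussian hlaw]
  have hmean₁ : ∫ z, z.1 ∂π = m₁ := by rw [← fst_integral hid.integrable, hmean]
  have hmean₂ : ∫ z, z.2 ∂π = m₂ := by rw [← snd_integral hid.integrable, hmean]
  have hcov : crossCov (fun z ↦ EuclideanSpace.sumEquivProd.symm (z.1, z.2))
      (fun z ↦ EuclideanSpace.sumEquivProd.symm (z.1, z.2)) π = fromBlocks M₁ C Cᵀ M₂ :=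
    crossCov_self_of_hasLaw_multivariateGaussian hC hlaw
  rw [crossCov_sumEquivProd_symm, fromBlocks_inj] at hcov
  obtain ⟨hcov₁, hcov₁₂, -, hcov₂⟩ := hcov
  refine ⟨π, ⟨hid.isProbabilityMeasure, ?_, ?_⟩, hcov₁₂⟩
  · rw [(hasLaw_multivariateGaussian_crossCov hid.fst).map_eq, hmean₁, hcov₁]
  · rw [(hasLaw_multivariateGaussian_crossCov hid.snd).map_eq, hmean₂, hcov₂]

theorem image_crossCov_couplings_multivariateGaussian (m₁ : EuclideanSpace ℝ ι)
    (m₂ : EuclideanSpace ℝ κ) (hM₁ : M₁.PosSemidef) (hM₂ : M₂.PosSemidef) :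
    (fun π ↦ crossCov Prod.fst Prod.snd π) ''
        couplings (multivariateGaussian m₁ M₁) (multivariateGaussian m₂ M₂) =
      {C | (fromBlocks M₁ C Cᵀ M₂).PosSemidef} := by
  ext C
  constructor
  · rintro ⟨π, hπ, rfl⟩
    have := hπ.1
    have hX := hasLaw_fst_of_mem_couplings hπ
    have hY := hasLaw_snd_of_mem_couplings hπ
    rw [Set.mem_ofPred_eq, ← crossCov_self_of_hasLaw_multivariateGaussian hM₁ hX,
      ← crossCov_self_of_hasLaw_multivariateGaussian hM₂ hY]
    exact posSemidef_fromBlocks_crossCov hX.hasGaussianLaw.memLp_two hY.hasGaussianLaw.memLp_two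
  · exact exists_mem_couplings_multivariateGaussian_crossCov_eq m₁ m₂

end Gaussian

section QuadraticCost

variable {ι κ : Type*} [Fintype ι] [Fintype κ]

/-- The cost `quadCost` for vectors `ξ₁ ∈ ℝ^ι`, `ξ₂ ∈ ℝ^κ` of possibly different dimensions. -/
def rectQuadCost (P : Matrix ι ι ℝ) (Q : Matrix κ κ ℝ) (R : Matrix ι κ ℝ)
    (ξ : EuclideanSpace ℝ ι × EuclideanSpace ℝ κ) : ℝ :=
  ξ.1.ofLp ⬝ᵥ P *ᵥ ξ.1.ofLp + ξ.2.ofLp ⬝ᵥ Q *ᵥ ξ.2.ofLp + ξ.1.ofLp ⬝ᵥ R *ᵥ ξ.2.ofLp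

variable {π : Measure (EuclideanSpace ℝ ι × EuclideanSpace ℝ κ)}

lemma integrable_rectQuadCost (h₁ : MemLp Prod.fst 2 π) (h₂ : MemLp Prod.snd 2 π)
    (P : Matrix ι ι ℝ) (Q : Matrix κ κ ℝ) (R : Matrix ι κ ℝ) :
    Integrable (rectQuadCost P Q R) π :=
  ((integrable_dotProduct_mulVec h₁ h₁ P).add (integrable_dotProduct_mulVec h₂ h₂ Q)).add
    (integrable_dotProduct_mulVec h₁ h₂ R)

lemma integral_rectQuadCost [IsProbabilityMeasure π] (h₁ : MemLp Prod.fst 2 π)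
    (h₂ : MemLp Prod.snd 2 π) (P : Matrix ι ι ℝ) (Q : Matrix κ κ ℝ) (R : Matrix ι κ ℝ) :
    ∫ ξ, rectQuadCost P Q R ξ ∂π =
      rectQuadCost P Q R (∫ ξ, ξ.1 ∂π, ∫ ξ, ξ.2 ∂π) + (P * crossCov Prod.fst Prod.fst π).trace +
        (Q * crossCov Prod.snd Prod.snd π).trace + (Rᵀ * crossCov Prod.fst Prod.snd π).trace := by
  have hP := integrable_dotProduct_mulVec h₁ h₁ P
  have hQ := integrable_dotProduct_mulVec h₂ h₂ Q
  have hR := integrable_dotProduct_mulVec h₁ h₂ R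
  simp only [rectQuadCost]
  rw [integral_add (by exact hP.add hQ) hR, integral_add hP hQ, integral_dotProduct_mulVec h₁ h₁,
    integral_dotProduct_mulVec h₂ h₂, integral_dotProduct_mulVec h₁ h₂,
    trace_transpose_mul_crossCov_self, trace_transpose_mul_crossCov_self]
  ring

variable [DecidableEq ι] [DecidableEq κ] {M₁ : Matrix ι ι ℝ} {M₂ : Matrix κ κ ℝ}

lemma transportCosts_multivariateGaussian_rectQuadCost (m₁ : EuclideanSpace ℝ ι)
    (m₂ : EuclideanSpace ℝ κ) (hM₁ : M₁.PosSemidef) (hM₂ : M₂.PosSemidef)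
    (P : Matrix ι ι ℝ) (Q : Matrix κ κ ℝ) (R : Matrix ι κ ℝ) :
    transportCosts (multivariateGaussian m₁ M₁) (multivariateGaussian m₂ M₂)
        (rectQuadCost P Q R) =
      (fun C ↦ rectQuadCost P Q R (m₁, m₂) + (P * M₁).trace + (Q * M₂).trace + (Rᵀ * C).trace) ''
        {C | (fromBlocks M₁ C Cᵀ M₂).PosSemidef} := by
  rw [← image_crossCov_couplings_multivariateGaussian m₁ m₂ hM₁ hM₂, Set.image_image,
    transportCosts_eq_image]
  refine Set.image_congr fun π hπ ↦ ?_
  have := hπ.1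
  have h₁ := hasLaw_fst_of_mem_couplings hπ
  have h₂ := hasLaw_snd_of_mem_couplings hπ
  rw [integral_rectQuadCost h₁.hasGaussianLaw.memLp_two h₂.hasGaussianLaw.memLp_two,
    integral_of_hasLaw_multivariateGaussian h₁, integral_of_hasLaw_multivariateGaussian h₂,
    crossCov_self_of_hasLaw_multivariateGaussian hM₁ h₁,
    crossCov_self_of_hasLaw_multivariateGaussian hM₂ h₂]

theorem corollary1_general (m₁ : EuclideanSpace ℝ ι) (m₂ : EuclideanSpace ℝ κ)
    (hM₁ : M₁.PosSemidef) (hM₂ : M₂.PosSemidef)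
    (P : Matrix ι ι ℝ) (Q : Matrix κ κ ℝ) (R : Matrix ι κ ℝ) :
    (∀ π ∈ couplings (multivariateGaussian m₁ M₁) (multivariateGaussian m₂ M₂),
      Integrable (rectQuadCost P Q R) π) ∧
    IsLeast
      (transportCosts (multivariateGaussian m₁ M₁) (multivariateGaussian m₂ M₂)
        (rectQuadCost P Q R))
      (rectQuadCost P Q R (m₁, m₂) + (P * M₁).trace + (Q * M₂).trace
        - (CFC.sqrt (CFC.sqrt M₁ * R * M₂ * Rᵀ * CFC.sqrt M₁)).trace) := by
  refine ⟨fun π hπ ↦ integrable_rectQuadCost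
    (hasLaw_fst_of_mem_couplings hπ).hasGaussianLaw.memLp_two
    (hasLaw_snd_of_mem_couplings hπ).hasGaussianLaw.memLp_two P Q R, ?_⟩
  rw [transportCosts_multivariateGaussian_rectQuadCost m₁ m₂ hM₁ hM₂, sub_eq_add_neg]
  set k := rectQuadCost P Q R (m₁, m₂) + (P * M₁).trace + (Q * M₂).trace
  have hmono : Monotone (k + ·) := fun _ _ h ↦ add_le_add_right h k
  simpa only [Set.image_image, RCLike.re_to_real, conjTranspose_eq_transpose_of_trivial] using
    hmono.map_isLeast (isLeast_re_trace_of_posSemidef_fromBlocks hM₁ hM₂ R)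

end QuadraticCost

theorem corollary1 (n : ℕ) (m₁ m₂ : EuclideanSpace ℝ (Fin n))
    (M₁ M₂ P Q R : Matrix (Fin n) (Fin n) ℝ)
    (hM₁ : M₁.PosSemidef) (hM₂ : M₂.PosSemidef)
    (hP : P.IsSymm) (hQ : Q.IsSymm) (hR : R.IsSymm) :
    (∀ π ∈ couplings (multivariateGaussian m₁ M₁) (multivariateGaussian m₂ M₂),
      Integrable (quadCost P Q R) π) ∧
    IsGLB
      (transportCosts (multivariateGaussian m₁ M₁) (multivariateGaussian m₂ M₂) (quadCost P Q R))
      (m₁.ofLp ⬝ᵥ P *ᵥ m₁.ofLp + m₂.ofLp ⬝ᵥ Q *ᵥ m₂.ofLp + m₁.ofLp ⬝ᵥ R *ᵥ m₂.ofLp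
        + (P * M₁).trace + (Q * M₂).trace
        - (CFC.sqrt (CFC.sqrt M₁ * R * M₂ * R * CFC.sqrt M₁)).trace) := by
  obtain ⟨hint, hleast⟩ := corollary1_general m₁ m₂ hM₁ hM₂ P Q R
  exact ⟨hint, (hR.eq ▸ hleast).isGLB⟩
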